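/- All Banach and Hilbert spaces are real. For Banach spaces $X,Y$, let $X\widehat{\otimes}_\pi Y$ be the completion of $X\otimes Y$ under the projective norm $\|z\|_\pi=\inf\{\sum_{i=1}^n\|x_i\|\|y_i\| : z=\sum_{i=1}^n x_i\otimes y_i\}$, and let $\operatorname{NA}_\pi(X\widehat{\otimes}_\pi Y)$ be the set of those $z\in X\widehat{\otimes}_\pi Y$ for which there are sequences $(x_n)$ in $X$ and $(y_n)$ in $Y$ with $z=\sum_{n=1}^\infty x_n\otimes y_n$ (convergence in norm) and $\|z\|=\sum_{n=1}^\infty\|x_n\|\|y_n\|$. A Banach space $X$ has the metric $\pi$-property if for every $\varepsilon>0$ and all finitely many $x_1,\dots,x_n$ in the unit sphere of $X$ there is a finite-dimensional subspace $M\subseteq X$, which is the range of a linear projection on $X$ of norm at most $1$, such that each $x_i$ lies at distance less than $\varepsilon$ from some element of $M$. The norm of $X$ locally depends upon finitely many coordinates if for every $x\in X\setminus\{0\}$ there are $\varepsilon>0$, functionals $f_1,\dots,f_N\in X^*$ and a continuous function $\varphi:\mathbb{R}^N\to\mathbb{R}$ such that $\|y\|=\varphi(f_1(y),\dots,f_N(y))$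 whenever $\|y-x\|<\varepsilon$. Theorem. Let $X$ be a Banach space with the metric $\pi$-property whose norm locally depends upon finitely many coordinates, and let $Y$ be a Hilbert space. Then $\operatorname{NA}_\pi(X\widehat{\otimes}_\pi Y)$ is dense in $X\widehat{\otimes}_\pi Y$. If moreover $X$ and $Y$ are infinite-dimensional, then the complement $(X\widehat{\otimes}_\pi Y)\setminus\operatorname{NA}_\pi(X\widehat{\otimes}_\pi Y)$ is also dense in $X\widehat{\otimes}_\pi Y$. In particular, for every set $I$ the space $c_0(I)$ has the metric $\pi$-property and its norm locally depends upon finitely many coordinates; hence, for every Hilbert space $Y$, $\operatorname{NA}_\pi(c_0(I)\widehat{\otimes}_\pi Y)$ is dense in $c_0(I)\widehat{\otimes}_\pi Y$, and so is its complement if $I$ is infinite and $Y$ is infinite-dimensional. -/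

import Mathlib

open scoped TensorProduct ZeroAtInfty

noncomputable section

namespace NormAttainingTensors

universe u v

/-- The metric `π`-property: every finite subset of the unit sphere can be approximated, up to any
`ε > 0`, from the range of a finite-rank continuous linear projection of norm at most one,
that is, from a finite-dimensional `1`-complemented subspace `M`. -/
def MetricPiProperty (X : Type u) [NormedAddCommGroup X] [NormedSpace ℝ X] : Prop :=
  ∀ ε : ℝ, 0 < ε → ∀ (n : ℕ) (x : Fin n → X), (∀ i, ‖x i‖ = 1) →
    ∃ M : Submodule ℝ X, FiniteDimensional ℝ M ∧
      (∃ P : X →L[ℝ] X, ‖P‖ ≤ 1 ∧ (∀ a, P a ∈ M) ∧ (∀ a ∈ M, P a = a)) ∧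
      ∀ i, ∃ x' ∈ M, ‖x i - x'‖ < ε

/-- The norm of `X` locally depends upon finitely many coordinates. -/
def NormLocallyDependsOnFinitelyManyCoordinates
    (X : Type u) [NormedAddCommGroup X] [NormedSpace ℝ X] : Prop :=
  ∀ x : X, x ≠ 0 → ∃ ε : ℝ, 0 < ε ∧ ∃ (N : ℕ) (f : Fin N → (X →L[ℝ] ℝ)) (φ : (Fin N → ℝ) → ℝ),
    Continuous φ ∧ ∀ y : X, ‖y - x‖ < ε → ‖y‖ = φ (fun i => f i y)

section Projective

variable (X : Type u) (Y : Type v) [NormedAddCommGroup X] [NormedSpace ℝ X]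
  [NormedAddCommGroup Y] [NormedSpace ℝ Y]

/-- The algebraic tensor product `X ⊗ Y`. It is a type synonym because the plain tensor product
of two inner product spaces already carries another norm in Mathlib. -/
def AlgTensor : Type (max u v) := X ⊗[ℝ] Y

instance : AddCommGroup (AlgTensor X Y) := inferInstanceAs (AddCommGroup (X ⊗[ℝ] Y))

instance : Module ℝ (AlgTensor X Y) := inferInstanceAs (Module ℝ (X ⊗[ℝ] Y))

variable {X Y}

/-- The elementary tensor `x ⊗ y`. -/
def AlgTensor.tmul (x : X) (y : Y) : AlgTensor X Y := x ⊗ₜ[ℝ] y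

theorem AlgTensor.add_tmul (x x' : X) (y : Y) : tmul (x + x') y = tmul x y + tmul x' y :=
  TensorProduct.add_tmul x x' y

theorem AlgTensor.smul_tmul (c : ℝ) (x : X) (y : Y) : tmul (c • x) y = c • tmul x y :=
  (TensorProduct.smul_tmul' c x y).symm

/-- The values `∑ ‖xᵢ‖ ‖yᵢ‖` over all finite representations `z = ∑ xᵢ ⊗ yᵢ`. -/
def reprCosts (z : AlgTensor X Y) : Set ℝ :=
  {r | ∃ (n : ℕ) (x : Fin n → X) (y : Fin n → Y),
    z = ∑ i, AlgTensor.tmul (x i) (y i) ∧ r = ∑ i, ‖x i‖ * ‖y i‖}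

/-- The projective norm `‖z‖_π = inf { ∑ ‖xᵢ‖ ‖yᵢ‖ : z = ∑ xᵢ ⊗ yᵢ }`. -/
def projNorm (z : AlgTensor X Y) : ℝ := sInf (reprCosts z)

theorem reprCosts_nonneg (z : AlgTensor X Y) {r : ℝ} (hr : r ∈ reprCosts z) : 0 ≤ r := by
  obtain ⟨n, x, y, -, rfl⟩ := hr
  positivity

theorem reprCosts_bddBelow (z : AlgTensor X Y) : BddBelow (reprCosts z) :=
  ⟨0, fun _ hr => reprCosts_nonneg z hr⟩

theorem reprCosts_zero : (0 : ℝ) ∈ reprCosts (0 : AlgTensor X Y) :=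
  ⟨0, Fin.elim0, Fin.elim0, by simp, by simp⟩

theorem reprCosts_add {z w : AlgTensor X Y} {r s : ℝ} (hr : r ∈ reprCosts z)
    (hs : s ∈ reprCosts w) : r + s ∈ reprCosts (z + w) := by
  obtain ⟨n, x, y, rfl, rfl⟩ := hr
  obtain ⟨m, x', y', rfl, rfl⟩ := hs
  exact ⟨n + m, Fin.append x x', Fin.append y y', by simp [Fin.sum_univ_add],
    by simp [Fin.sum_univ_add]⟩

theorem reprCosts_smul (c : ℝ) {z : AlgTensor X Y} {r : ℝ} (hr : r ∈ reprCosts z) :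
    |c| * r ∈ reprCosts (c • z) := by
  obtain ⟨n, x, y, rfl, rfl⟩ := hr
  refine ⟨n, fun i => c • x i, y, ?_, ?_⟩
  · simp [AlgTensor.smul_tmul, Finset.smul_sum]
  · simp [norm_smul, Finset.mul_sum, mul_assoc]

theorem reprCosts_nonempty (z : AlgTensor X Y) : (reprCosts z).Nonempty := by
  refine TensorProduct.induction_on (motive := fun z => (reprCosts (X := X) (Y := Y) z).Nonempty)
    z ⟨0, reprCosts_zero⟩ ?_ ?_
  · exact fun x y => ⟨‖x‖ * ‖y‖, 1, fun _ => x, fun _ => y,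
      (Fin.sum_univ_one fun _ => AlgTensor.tmul x y).symm, by simp⟩
  · rintro a b ⟨r, hr⟩ ⟨s, hs⟩
    exact ⟨r + s, reprCosts_add hr hs⟩

theorem projNorm_nonneg (z : AlgTensor X Y) : 0 ≤ projNorm z :=
  Real.sInf_nonneg fun _ hr => reprCosts_nonneg z hr

theorem projNorm_add_le (z w : AlgTensor X Y) : projNorm (z + w) ≤ projNorm z + projNorm w := by
  refine le_of_forall_pos_le_add fun ε hε => ?_
  obtain ⟨r, hr, hr'⟩ := Real.lt_sInf_add_pos (reprCosts_nonempty z) (half_pos hε)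
  obtain ⟨s, hs, hs'⟩ := Real.lt_sInf_add_pos (reprCosts_nonempty w) (half_pos hε)
  have := csInf_le (reprCosts_bddBelow _) (reprCosts_add hr hs)
  simp only [projNorm]
  linarith

theorem projNorm_smul_le (c : ℝ) (z : AlgTensor X Y) : projNorm (c • z) ≤ |c| * projNorm z := by
  refine le_of_forall_pos_le_add fun ε hε => ?_
  have hc : 0 < |c| + 1 := by positivity
  obtain ⟨r, hr, hr'⟩ := Real.lt_sInf_add_pos (reprCosts_nonempty z) (div_pos hε hc)
  have h1 := csInf_le (reprCosts_bddBelow _) (reprCosts_smul c hr)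
  have h2 : |c| * r ≤ |c| * (projNorm z + ε / (|c| + 1)) :=
    mul_le_mul_of_nonneg_left hr'.le (abs_nonneg c)
  have h3 : |c| * (ε / (|c| + 1)) ≤ ε := by
    rw [mul_div_assoc', div_le_iff₀ hc]
    nlinarith
  simp only [projNorm] at *
  linarith

variable (X Y)

/-- The projective norm as a seminorm. -/
def projSeminorm : Seminorm ℝ (AlgTensor X Y) :=
  Seminorm.ofSMulLE projNorm
    (le_antisymm (csInf_le (reprCosts_bddBelow _) reprCosts_zero) (projNorm_nonneg _))
    projNorm_add_le projNorm_smul_le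

instance : SeminormedAddCommGroup (AlgTensor X Y) :=
  (projSeminorm X Y).toAddGroupSeminorm.toSeminormedAddCommGroup

theorem AlgTensor.norm_def (z : AlgTensor X Y) : ‖z‖ = projNorm z := rfl

instance : NormedSpace ℝ (AlgTensor X Y) where
  norm_smul_le c z := projNorm_smul_le c z

/-- The projective tensor product: the completion of `X ⊗ Y` for the projective norm. The projective
norm is only shown here to be a seminorm, which is all that the completion needs. -/
abbrev ProjTensor : Type (max u v) := UniformSpace.Completion (AlgTensor X Y)

/-- The set of elements `z` attaining their projective norm: `z = ∑ xₙ ⊗ yₙ` in norm, with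
`‖z‖ = ∑ ‖xₙ‖ ‖yₙ‖`. -/
def NApi : Set (ProjTensor X Y) :=
  {z | ∃ (x : ℕ → X) (y : ℕ → Y),
    HasSum (fun n => ‖x n‖ * ‖y n‖) ‖z‖ ∧
    HasSum (fun n => ((AlgTensor.tmul (x n) (y n) : AlgTensor X Y) : ProjTensor X Y)) z}

end Projective

end NormAttainingTensors

end

/-! Density: an algebraic tensor can be moved slightly into `M ⊗ N`, where `M` comes from the metric
π-property and `N` is the span of the second factors, 1-complemented by orthogonal projection.
Pushing a representation through `P ⊗ Q` never raises its cost, so the infimum may be taken inside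
`M ⊗ N`; there compactness of the hull of products of unit balls makes it a minimum
(`sum_tmulL_mem_NApi`).

Complement: a functional norming `z = ∑ xₙ ⊗ yₙ` norms every term. By Riesz it is a contraction `T :
X → Y` that preserves the norm of `xₙ` and sends it to a multiple of `yₙ`. Such a `T` has finite
rank: near `xₙ` the norm of `X` is constant along a subspace of finite codimension, which the
parallelogram law forces `T` to annihilate. Hence norm-attaining tensors have finite rank
(`isFiniteRank_of_mem_NApi`), and adding a small multiple of an infinite-rank tensor leaves the set.
-/

noncomputable section

namespace NormAttainingTensors

open Filter Topology Pointwise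

/-! ### Carathéodory and compact convex hulls. -/

section Convex

variable {E : Type*} [NormedAddCommGroup E] [NormedSpace ℝ E]

/-- The convex hull of a compact set with finite-dimensional span is compact. -/
theorem isCompact_convexHull_of_finiteDimensional_span {K : Set E} (hK : IsCompact K)
    [FiniteDimensional ℝ (Submodule.span ℝ K)] : IsCompact (convexHull ℝ K) := by
  set d := Module.finrank ℝ (Submodule.span ℝ K)
  -- Carathéodory: affinely independent points of `K` number at most `d + 1`, so finitely many
  -- continuous images of compact sets exhaust the hull.
  have key : convexHull ℝ K = ⋃ k ∈ Finset.range (d + 2),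
      (fun p : (Fin k → ℝ) × (Fin k → E) => ∑ i, p.1 i • p.2 i) ''
        (stdSimplex ℝ (Fin k) ×ˢ Set.univ.pi fun _ => K) := by
    apply Set.Subset.antisymm
    · intro x hx
      obtain ⟨ι, _, z, w, hz, hai, hw0, hw1, hx⟩ := eq_pos_convex_span_of_mem_convexHull hx
      have hspan : vectorSpan ℝ (Set.range z) ≤ Submodule.span ℝ K := by
        rw [vectorSpan_def, Submodule.span_le]
        rintro _ ⟨a, ha, b, hb, rfl⟩
        exact sub_mem (Submodule.subset_span (hz ha)) (Submodule.subset_span (hz hb))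
      have hcard : Fintype.card ι ≤ d + 1 :=
        hai.card_le_finrank_succ.trans (Nat.succ_le_succ (Submodule.finrank_mono hspan))
      have e := (Fintype.equivFin ι).symm
      refine Set.mem_biUnion (x := Fintype.card ι)
        (Finset.mem_coe.2 (Finset.mem_range.2 (by omega))) ?_
      refine ⟨(w ∘ e, z ∘ e), ⟨⟨fun i => (hw0 _).le, ?_⟩, fun i _ => hz ⟨_, rfl⟩⟩, ?_⟩
      · simpa using (e.sum_comp w).trans hw1
      · simpa using (e.sum_comp fun i => w i • z i).trans hx
    · refine Set.iUnion₂_subset fun k _ => ?_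
      rintro _ ⟨⟨w, z⟩, ⟨hw, hz⟩, rfl⟩
      exact (convex_convexHull ℝ K).sum_mem (fun i _ => hw.1 i) hw.2
        fun i _ => subset_convexHull ℝ K (hz i trivial)
  rw [key]
  refine (Finset.range (d + 2)).isCompact_biUnion fun k _ => ?_
  exact ((isCompact_stdSimplex ℝ (Fin k)).prod (isCompact_univ_pi fun _ => hK)).image (by fun_prop)

end Convex

/-! ### Bilinear maps on the projective tensor product; attainment in finite dimensions. -/

section Projective

variable {X : Type*} {Y : Type*} [NormedAddCommGroup X] [NormedSpace ℝ X]
  [NormedAddCommGroup Y] [NormedSpace ℝ Y]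

theorem norm_le_of_mem_reprCosts {z : AlgTensor X Y} {r : ℝ} (hr : r ∈ reprCosts z) : ‖z‖ ≤ r :=
  csInf_le (reprCosts_bddBelow z) hr

theorem norm_tmul_le (x : X) (y : Y) : ‖AlgTensor.tmul x y‖ ≤ ‖x‖ * ‖y‖ :=
  norm_le_of_mem_reprCosts ⟨1, fun _ => x, fun _ => y,
    (Fin.sum_univ_one fun _ => AlgTensor.tmul x y).symm, by simp⟩

variable (X Y)

/-- The continuous bilinear map `(x, y) ↦ x ⊗ y` into the projective tensor product. -/
def tmulL : X →L[ℝ] Y →L[ℝ] ProjTensor X Y :=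
  LinearMap.mkContinuous₂
    ((TensorProduct.mk ℝ X Y : X →ₗ[ℝ] Y →ₗ[ℝ] AlgTensor X Y).compr₂
      (UniformSpace.Completion.toComplL (𝕜 := ℝ) (E := AlgTensor X Y)).toLinearMap) 1
    fun x y => by
      have := norm_tmul_le x y
      rw [one_mul]
      exact (UniformSpace.Completion.norm_coe (AlgTensor.tmul x y)).trans_le this

variable {X Y}

theorem tmulL_apply (x : X) (y : Y) :
    tmulL X Y x y = ((AlgTensor.tmul x y : AlgTensor X Y) : ProjTensor X Y) := rfl

theorem norm_tmulL_apply_le (x : X) (y : Y) : ‖tmulL X Y x y‖ ≤ ‖x‖ * ‖y‖ :=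
  (UniformSpace.Completion.norm_coe (AlgTensor.tmul x y)).trans_le (norm_tmul_le x y)

theorem coe_sum_tmul {ι : Type*} (s : Finset ι) (x : ι → X) (y : ι → Y) :
    ((∑ i ∈ s, AlgTensor.tmul (x i) (y i) : AlgTensor X Y) : ProjTensor X Y) =
      ∑ i ∈ s, tmulL X Y (x i) (y i) :=
  map_sum (UniformSpace.Completion.toComplL (𝕜 := ℝ) (E := AlgTensor X Y)) _ s

theorem mem_NApi_iff {z : ProjTensor X Y} : z ∈ NApi X Y ↔ ∃ (x : ℕ → X) (y : ℕ → Y),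
    HasSum (fun n => ‖x n‖ * ‖y n‖) ‖z‖ ∧ HasSum (fun n => tmulL X Y (x n) (y n)) z :=
  Iff.rfl

/-- A finite representation of cost at most `‖z‖` shows that `z` attains its projective norm. -/
theorem mem_NApi_of_sum {ι : Type*} [Fintype ι] {z : ProjTensor X Y} (x : ι → X) (y : ι → Y)
    (hz : ∑ i, tmulL X Y (x i) (y i) = z) (hc : ∑ i, ‖x i‖ * ‖y i‖ ≤ ‖z‖) : z ∈ NApi X Y := by
  have hc' : ∑ i, ‖x i‖ * ‖y i‖ = ‖z‖ := by
    refine le_antisymm hc ?_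
    rw [← hz]
    exact (norm_sum_le _ _).trans (Finset.sum_le_sum fun i _ => norm_tmulL_apply_le _ _)
  let g : ι → ℕ := fun i => (Fintype.equivFin ι i : ℕ)
  have hg : Function.Injective g := Fin.val_injective.comp (Fintype.equivFin ι).injective
  have hx0 : ∀ n ∉ Set.range g, Function.extend g x 0 n = 0 := fun n hn => by
    rw [Function.extend_apply' _ _ _ hn]; rfl
  refine mem_NApi_iff.2 ⟨Function.extend g x 0, Function.extend g y 0, ?_, ?_⟩
  · rw [← hg.hasSum_iff fun n hn => by simp [hx0 n hn], ← hc']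
    convert hasSum_fintype (fun i => ‖x i‖ * ‖y i‖) using 2 with i
    simp [hg.extend_apply]
  · rw [← hg.hasSum_iff fun n hn => by simp [hx0 n hn], ← hz]
    convert hasSum_fintype (fun i => tmulL X Y (x i) (y i)) using 2 with i
    simp [hg.extend_apply]

section Lift

variable {W : Type*} [NormedAddCommGroup W] [NormedSpace ℝ W]

/-- The linearization of a bounded bilinear map on the algebraic tensor product. -/
def AlgTensor.lift (b : X →L[ℝ] Y →L[ℝ] W) : AlgTensor X Y →L[ℝ] W :=
  LinearMap.mkContinuous (TensorProduct.lift b.toLinearMap₁₂ : X ⊗[ℝ] Y →ₗ[ℝ] W) (‖b‖ + 1)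
    fun z => by
      -- The bound `‖b‖ + 1` stays positive when `b = 0`, so one may divide by it.
      have hb : 0 < ‖b‖ + 1 := by have := b.opNorm_nonneg; linarith
      rw [← div_le_iff₀' hb]
      refine le_csInf (reprCosts_nonempty z) ?_
      rintro _ ⟨n, x, y, rfl, rfl⟩
      rw [div_le_iff₀' hb, Finset.mul_sum]
      have h1 : (TensorProduct.lift b.toLinearMap₁₂ : X ⊗[ℝ] Y →ₗ[ℝ] W)
          (∑ i, AlgTensor.tmul (x i) (y i) : AlgTensor X Y) = ∑ i, b (x i) (y i) :=
        (map_sum (TensorProduct.lift b.toLinearMap₁₂) _ _).trans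
          (Finset.sum_congr rfl fun i _ => TensorProduct.lift.tmul _ _)
      refine (congrArg norm h1).trans_le ((norm_sum_le _ _).trans
        (Finset.sum_le_sum fun i _ => (b.le_opNorm₂ _ _).trans ?_))
      rw [mul_assoc]
      exact mul_le_mul_of_nonneg_right (by linarith) (by positivity)

variable [CompleteSpace W]

/-- The linearization of a bounded bilinear map on the projective tensor product. -/
def lift (b : X →L[ℝ] Y →L[ℝ] W) : ProjTensor X Y →L[ℝ] W :=
  (AlgTensor.lift b).extend (UniformSpace.Completion.toComplL (𝕜 := ℝ) (E := AlgTensor X Y))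

theorem lift_tmulL (b : X →L[ℝ] Y →L[ℝ] W) (x : X) (y : Y) : lift b (tmulL X Y x y) = b x y :=
  (ContinuousLinearMap.extend_eq (AlgTensor.lift b)
    UniformSpace.Completion.denseRange_coe
    (UniformSpace.Completion.isUniformInducing_coe _) (AlgTensor.tmul x y)).trans
    (TensorProduct.lift.tmul x y)

end Lift

/-- Tensors in `M ⊗ N` attain their norm if `M` and `N` are finite-dimensional and
`1`-complemented. -/
theorem sum_tmulL_mem_NApi {M : Submodule ℝ X} {N : Submodule ℝ Y} [FiniteDimensional ℝ M]
    [FiniteDimensional ℝ N] {P : X →L[ℝ] X} {Q : Y →L[ℝ] Y} (hP : ‖P‖ ≤ 1) (hQ : ‖Q‖ ≤ 1)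
    (hPM : ∀ a, P a ∈ M) (hQN : ∀ b, Q b ∈ N) (hP' : ∀ a ∈ M, P a = a) (hQ' : ∀ b ∈ N, Q b = b)
    {n : ℕ} (x : Fin n → X) (y : Fin n → Y) (hx : ∀ i, x i ∈ M) (hy : ∀ i, y i ∈ N) :
    ∑ i, tmulL X Y (x i) (y i) ∈ NApi X Y := by
  set t : AlgTensor X Y := ∑ i, AlgTensor.tmul (x i) (y i) with ht
  rw [← coe_sum_tmul, ← ht]
  set f : M × N → ProjTensor X Y := fun p => tmulL X Y p.1 p.2 with hf
  set K : Set (ProjTensor X Y) := f '' (Metric.closedBall 0 1 ×ˢ Metric.closedBall 0 1)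
  have hKc : IsCompact K :=
    ((isCompact_closedBall _ _).prod (isCompact_closedBall _ _)).image (by fun_prop)
  have hfin : FiniteDimensional ℝ (Submodule.span ℝ K) := by
    let B : M →ₗ[ℝ] N →ₗ[ℝ] ProjTensor X Y :=
      (tmulL X Y).toLinearMap₁₂.compl₁₂ M.subtype N.subtype
    have hle : Submodule.span ℝ K ≤ LinearMap.range (TensorProduct.lift B) := by
      rw [Submodule.span_le]
      rintro _ ⟨⟨a, b⟩, -, rfl⟩
      exact ⟨a ⊗ₜ b, by simp [B, hf]⟩
    exact Submodule.finiteDimensional_of_le hle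
  have hconv := isCompact_convexHull_of_finiteDimensional_span hKc
  have h0K : (0 : ProjTensor X Y) ∈ convexHull ℝ K :=
    subset_convexHull ℝ K ⟨0, by simp, by simp [hf]⟩
  -- `P ⊗ Q` fixes `t` and maps any representation in `X ⊗ Y` to one in `M ⊗ N` of no greater cost.
  have hmem : ∀ r ∈ reprCosts t, (t : ProjTensor X Y) ∈ r • convexHull ℝ K := by
    rintro _ ⟨m, u, v, hrep, rfl⟩
    have hrep' : (t : ProjTensor X Y) = ∑ i, tmulL X Y (P (u i)) (Q (v i)) := by
      have h1 : lift ((tmulL X Y).bilinearComp P Q) (t : ProjTensor X Y) = t := by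
        rw [ht, coe_sum_tmul, map_sum]
        refine Finset.sum_congr rfl fun i _ => ?_
        rw [lift_tmulL]
        simp [hP' _ (hx i), hQ' _ (hy i)]
      rw [← h1, hrep, coe_sum_tmul, map_sum]
      refine Finset.sum_congr rfl fun i _ => ?_
      rw [lift_tmulL]
      simp
    have hterm : ∀ i, tmulL X Y (P (u i)) (Q (v i)) ∈ (‖u i‖ * ‖v i‖) • convexHull ℝ K := by
      intro i
      by_cases h : ‖u i‖ * ‖v i‖ = 0
      · rw [h]
        refine ⟨0, h0K, ?_⟩
        rcases mul_eq_zero.1 h with h | h <;> simp [norm_eq_zero.1 h]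
      · rw [← ne_eq, mul_ne_zero_iff] at h
        refine ⟨tmulL X Y (‖u i‖⁻¹ • P (u i)) (‖v i‖⁻¹ • Q (v i)), subset_convexHull ℝ K
          ⟨(⟨_, M.smul_mem _ (hPM (u i))⟩, ⟨_, N.smul_mem _ (hQN (v i))⟩), ⟨?_, ?_⟩, rfl⟩, ?_⟩
        · have := (P.le_of_opNorm_le hP (u i))
          rw [one_mul] at this
          simpa [norm_smul] using inv_mul_le_one_of_le₀ this (norm_nonneg _)
        · have := (Q.le_of_opNorm_le hQ (v i))
          rw [one_mul] at this
          simpa [norm_smul] using inv_mul_le_one_of_le₀ this (norm_nonneg _)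
        · simp only [map_smul, smul_apply, smul_smul]
          rw [show ‖u i‖ * ‖v i‖ * (‖v i‖⁻¹ * ‖u i‖⁻¹) = 1 by field_simp [h.1, h.2], one_smul]
    have hsum : ∀ s : Finset (Fin m), ∑ i ∈ s, tmulL X Y (P (u i)) (Q (v i)) ∈
        (∑ i ∈ s, ‖u i‖ * ‖v i‖) • convexHull ℝ K := by
      intro s
      induction s using Finset.cons_induction with
      | empty => exact ⟨0, h0K, by simp⟩
      | cons a s ha ih =>
        rw [Finset.sum_cons, Finset.sum_cons, (convex_convexHull ℝ K).add_smul (by positivity)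
          (Finset.sum_nonneg fun i _ => by positivity)]
        exact Set.add_mem_add (hterm a) ih
    rw [hrep']
    exact hsum _
  -- Costs tending to the infimum give points of the hull; a convergent subsequence yields a
  -- minimizer.
  have hnorm : (t : ProjTensor X Y) ∈ ‖t‖ • convexHull ℝ K := by
    obtain ⟨r, -, hrt, hr⟩ := exists_seq_tendsto_sInf (reprCosts_nonempty t) (reprCosts_bddBelow t)
    choose c hc hct using fun k => hmem (r k) (hr k)
    obtain ⟨c₀, hc₀, φ, hφ, hlim⟩ := hconv.tendsto_subseq hc
    refine ⟨c₀, hc₀, ?_⟩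
    refine tendsto_nhds_unique ((hrt.comp hφ.tendsto_atTop).smul hlim) ?_
    have : (fun k => (r ∘ φ) k • (c ∘ φ) k) = fun _ => (t : ProjTensor X Y) :=
      funext fun k => hct (φ k)
    rw [this]
    exact tendsto_const_nhds
  obtain ⟨c, hc, hct⟩ := hnorm
  rw [convexHull_eq] at hc
  obtain ⟨ι, s, w, g, hw0, hw1, hg, rfl⟩ := hc
  choose p hp hpg using fun i : s => hg i i.2
  -- A convex combination of products of unit-ball elements, scaled by `‖t‖`, costs at most `‖t‖`.
  refine mem_NApi_of_sum (ι := s) (fun i => (‖t‖ * w i) • (p i).1.1) (fun i => (p i).2.1) ?_ ?_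
  · simp only at hct
    rw [← hct, Finset.centerMass_eq_of_sum_1 _ _ hw1, Finset.smul_sum, ← Finset.sum_coe_sort s]
    refine Finset.sum_congr rfl fun i _ => ?_
    rw [← hpg i, map_smul, smul_apply, smul_smul]
  · rw [UniformSpace.Completion.norm_coe]
    calc ∑ i : s, ‖(‖t‖ * w i) • (p i).1.1‖ * ‖(p i).2.1‖
        ≤ ∑ i : s, ‖t‖ * w i := by
          refine Finset.sum_le_sum fun i _ => ?_
          have h1 : ‖(p i).1.1‖ ≤ 1 := by simpa using (hp i).1
          have h2 : ‖(p i).2.1‖ ≤ 1 := by simpa using (hp i).2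
          have h3 := hw0 i i.2
          rw [norm_smul, Real.norm_of_nonneg (by positivity), mul_assoc]
          exact mul_le_of_le_one_right (by positivity) (mul_le_one₀ h1 (norm_nonneg _) h2)
      _ = ‖t‖ := by
          rw [← Finset.mul_sum, Finset.sum_coe_sort s w, hw1, mul_one]

/-- Frees the metric π-property from unit vectors by rescaling; the tolerance is divided by a bound
for all the norms. -/
theorem MetricPiProperty.exists_approx (hX : MetricPiProperty X) {ε : ℝ} (hε : 0 < ε) {n : ℕ}
    (x : Fin n → X) : ∃ M : Submodule ℝ X, FiniteDimensional ℝ M ∧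
      (∃ P : X →L[ℝ] X, ‖P‖ ≤ 1 ∧ (∀ a, P a ∈ M) ∧ (∀ a ∈ M, P a = a)) ∧
      ∀ i, ∃ x' ∈ M, ‖x i - x'‖ < ε := by
  classical
  by_cases h : ∃ j, x j ≠ 0
  · obtain ⟨j, hj⟩ := h
    obtain ⟨u, hu⟩ : ∃ u : Fin n → X, ∀ i, ‖u i‖ = 1 ∧ x i = ‖x i‖ • u i := by
      -- Zero entries need some unit vector too; they borrow the normalization of the nonzero `x j`.
      refine ⟨fun i => if x i = 0 then ‖x j‖⁻¹ • x j else ‖x i‖⁻¹ • x i, fun i => ?_⟩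
      by_cases hi : x i = 0
      · simp [hi, norm_smul, hj]
      · simp [hi, norm_smul, smul_smul]
    have hC : 0 < ∑ i, ‖x i‖ + 1 := by positivity
    obtain ⟨M, hM, hP, hu'⟩ := hX (ε / (∑ i, ‖x i‖ + 1)) (by positivity) n u fun i => (hu i).1
    refine ⟨M, hM, hP, fun i => ?_⟩
    obtain ⟨u', hu'M, hlt⟩ := hu' i
    refine ⟨‖x i‖ • u', M.smul_mem _ hu'M, ?_⟩
    rw [lt_div_iff₀ hC] at hlt
    have hle : ‖x i‖ ≤ ∑ i, ‖x i‖ :=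
      Finset.single_le_sum (f := fun i => ‖x i‖) (fun i _ => norm_nonneg _) (Finset.mem_univ i)
    calc ‖x i - ‖x i‖ • u'‖ = ‖‖x i‖ • (u i - u')‖ := by rw [smul_sub, ← (hu i).2]
      _ = ‖u i - u'‖ * ‖x i‖ := by rw [norm_smul, norm_norm, mul_comm]
      _ ≤ ‖u i - u'‖ * (∑ i, ‖x i‖ + 1) := by gcongr; linarith
      _ < ε := hlt
  · push Not at h
    exact ⟨⊥, inferInstance, ⟨0, by simp, by simp, by simp⟩, fun i => ⟨0, by simp, by simp [h i, hε]⟩⟩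

end Projective

/-! ### Density of the norm-attaining tensors. -/

section Hilbert

variable {X : Type*} {Y : Type*} [NormedAddCommGroup X] [NormedSpace ℝ X]
  [NormedAddCommGroup Y] [InnerProductSpace ℝ Y]

theorem dense_NApi_of_metricPiProperty (hX : MetricPiProperty X) : Dense (NApi X Y) := by
  have halg : ∀ t : AlgTensor X Y, (t : ProjTensor X Y) ∈ closure (NApi X Y) := by
    intro t
    obtain ⟨r, n, x, y, rfl, -⟩ := reprCosts_nonempty t
    rw [coe_sum_tmul, Metric.mem_closure_iff]
    intro ε hε
    have hC : 0 < ∑ i, ‖y i‖ + 1 := by positivity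
    obtain ⟨M, hM, ⟨P, hP, hPM, hP'⟩, hx'⟩ :=
      hX.exists_approx (ε := ε / (∑ i, ‖y i‖ + 1)) (by positivity) x
    choose x' hx'M hlt using hx'
    let N := Submodule.span ℝ (Set.range y)
    have hN : FiniteDimensional ℝ N := FiniteDimensional.span_of_finite ℝ (Set.finite_range y)
    refine ⟨_, sum_tmulL_mem_NApi (M := M) (N := N) (Q := N.starProjection) hP
      N.starProjection_norm_le hPM (fun b => N.starProjection_apply_mem b) hP'
      (fun b hb => Submodule.starProjection_eq_self_iff.2 hb) x' y hx'M
      fun i => Submodule.subset_span ⟨i, rfl⟩, ?_⟩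
    rw [dist_eq_norm, ← Finset.sum_sub_distrib]
    calc ‖∑ i, (tmulL X Y (x i) (y i) - tmulL X Y (x' i) (y i))‖
        ≤ ∑ i, ε / (∑ i, ‖y i‖ + 1) * ‖y i‖ := by
          refine (norm_sum_le _ _).trans (Finset.sum_le_sum fun i _ => ?_)
          rw [← sub_apply, ← map_sub]
          exact (norm_tmulL_apply_le _ _).trans (by gcongr; exact (hlt i).le)
      _ = ε / (∑ i, ‖y i‖ + 1) * ∑ i, ‖y i‖ := by rw [Finset.mul_sum]
      _ < ε / (∑ i, ‖y i‖ + 1) * (∑ i, ‖y i‖ + 1) := by gcongr; linarith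
      _ = ε := div_mul_cancel₀ _ hC.ne'
  intro z
  refine UniformSpace.Completion.induction_on z isClosed_closure halg

end Hilbert

/-! ### Slices and finite rank. -/

section Contraction

variable {X : Type*} {Y : Type*} [NormedAddCommGroup X] [NormedSpace ℝ X] [CompleteSpace X]
  [NormedAddCommGroup Y] [NormedSpace ℝ Y]

/-- The slice map `x ⊗ y ↦ c(y) x` given by a functional `c` on the second factor. -/
def slice (c : Y →L[ℝ] ℝ) : ProjTensor X Y →L[ℝ] X :=
  lift (ContinuousLinearMap.smulRightL ℝ Y X c)

@[simp]
theorem slice_tmulL (c : Y →L[ℝ] ℝ) (x : X) (y : Y) : slice c (tmulL X Y x y) = c y • x :=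
  lift_tmulL _ x y

/-- A tensor has finite rank if its slices lie in a finite-dimensional subspace. -/
def IsFiniteRank (z : ProjTensor X Y) : Prop :=
  ∃ F : Submodule ℝ X, FiniteDimensional ℝ F ∧ ∀ c : Y →L[ℝ] ℝ, slice c z ∈ F

theorem IsFiniteRank.of_add_smul {z w : ProjTensor X Y} {δ : ℝ} (hδ : δ ≠ 0)
    (hz : IsFiniteRank z) (hzw : IsFiniteRank (z + δ • w)) : IsFiniteRank w := by
  obtain ⟨F, hF, hFz⟩ := hz
  obtain ⟨G, hG, hGz⟩ := hzw
  refine ⟨F ⊔ G, inferInstance, fun c => ?_⟩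
  have h : slice c w = δ⁻¹ • (slice c (z + δ • w) - slice c z) := by
    simp [smul_smul, hδ]
  rw [h]
  exact Submodule.smul_mem _ _ (sub_mem (Submodule.mem_sup_right (hGz c))
    (Submodule.mem_sup_left (hFz c)))

end Contraction

theorem exists_nat_linearIndependent {E : Type*} [AddCommGroup E] [Module ℝ E]
    (hE : ¬ FiniteDimensional ℝ E) : ∃ v : ℕ → E, LinearIndependent ℝ v := by
  let b := Module.Basis.ofVectorSpace ℝ E
  have : Infinite (Module.Basis.ofVectorSpaceIndex ℝ E) := by
    by_contra h
    rw [not_infinite_iff_finite] at h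
    exact hE (Module.Finite.of_basis b)
  exact ⟨_, b.linearIndependent.comp _ (Infinite.natEmbedding _).injective⟩

theorem LinearIndependent.not_finiteDimensional_of_mem {E ι : Type*} [AddCommGroup E] [Module ℝ E]
    [Infinite ι] {v : ι → E} (hv : LinearIndependent ℝ v) {F : Submodule ℝ E}
    (hF : ∀ i, v i ∈ F) : ¬ FiniteDimensional ℝ F := fun _ =>
  have h : LinearIndependent ℝ (fun i => (⟨v i, hF i⟩ : F)) :=
    LinearIndependent.of_comp F.subtype hv
  not_finite_iff_infinite.2 ‹Infinite ι› h.finite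

/-! ### Norm-attaining tensors have finite rank; density of the complement. -/

section Hilbert

variable {X : Type*} {Y : Type*} [NormedAddCommGroup X] [NormedSpace ℝ X]
  [NormedAddCommGroup Y] [InnerProductSpace ℝ Y]

/-- Linear operators of norm at most one into a Hilbert space that attain the norm one have finite
rank, when the norm of the domain locally depends upon finitely many coordinates. -/
theorem NormLocallyDependsOnFinitelyManyCoordinates.finiteDimensional_range
    (hX : NormLocallyDependsOnFinitelyManyCoordinates X) {T : X →ₗ[ℝ] Y}
    (hT : ∀ x, ‖T x‖ ≤ ‖x‖) {x₀ : X} (hx₀ : x₀ ≠ 0) (hTx₀ : ‖T x₀‖ = ‖x₀‖) :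
    FiniteDimensional ℝ (LinearMap.range T) := by
  obtain ⟨ε, hε, N, f, φ, -, hφ⟩ := hX x₀ hx₀
  let S : X →ₗ[ℝ] Fin N → ℝ := LinearMap.pi fun i => (f i).toLinearMap
  have hnorm : ∀ h ∈ LinearMap.ker S, ‖h‖ < ε → ‖x₀ + h‖ = ‖x₀‖ := by
    intro h hh hlt
    have hf : ∀ i, f i h = 0 := fun i => congrFun (LinearMap.mem_ker.1 hh) i
    rw [hφ (x₀ + h) (by simpa using hlt), hφ x₀ (by simpa using hε)]
    simp [hf]
  -- Both `T x₀ ± T h` have norm at most `‖T x₀‖`, so the parallelogram law leaves no room for `T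
  -- h`.
  have hsmall : ∀ h ∈ LinearMap.ker S, ‖h‖ < ε → T h = 0 := by
    intro h hh hlt
    have h1 := hT (x₀ + h)
    have h2 := hT (x₀ - h)
    rw [hnorm h hh hlt, map_add] at h1
    rw [sub_eq_add_neg, hnorm (-h) (neg_mem hh) (by simpa using hlt), ← sub_eq_add_neg,
      map_sub] at h2
    have h3 := parallelogram_law_with_norm ℝ (T x₀) (T h)
    rw [hTx₀] at h3
    have h4 : ‖T h‖ * ‖T h‖ ≤ 0 := by
      nlinarith [mul_self_le_mul_self (norm_nonneg _) h1, mul_self_le_mul_self (norm_nonneg _) h2]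
    exact norm_eq_zero.1 (mul_self_eq_zero.1 (le_antisymm h4 (mul_self_nonneg _)))
  have hker : LinearMap.ker S ≤ LinearMap.ker T := by
    intro h hh
    have hpos : 0 < ε / (‖h‖ + 1) := by positivity
    have hs : T ((ε / (‖h‖ + 1)) • h) = 0 := by
      refine hsmall _ (Submodule.smul_mem _ _ hh) ?_
      rw [norm_smul, Real.norm_of_nonneg hpos.le, div_mul_eq_mul_div, div_lt_iff₀ (by positivity)]
      nlinarith
    rw [map_smul] at hs
    exact (smul_eq_zero.1 hs).resolve_left hpos.ne'
  have hcofg : (LinearMap.ker S).CoFG := Submodule.CoFG.ker S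
  exact Module.Finite.iff_fg.2 (Submodule.range_fg_iff_ker_cofg.2 (hcofg.of_le hker))

variable [CompleteSpace X]

/-- The witness pairs independent `x k`, scaled for summability, with an orthonormal sequence;
slicing by `e k` recovers a nonzero multiple of `x k`. -/
theorem exists_not_isFiniteRank (hX : ¬ FiniteDimensional ℝ X) (hY : ¬ FiniteDimensional ℝ Y) :
    ∃ w : ProjTensor X Y, ¬ IsFiniteRank w := by
  obtain ⟨x, hx⟩ := exists_nat_linearIndependent hX
  obtain ⟨y, hy⟩ := exists_nat_linearIndependent hY
  set e : ℕ → Y := InnerProductSpace.gramSchmidtNormed ℝ y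
  have he : Orthonormal ℝ e := InnerProductSpace.gramSchmidtNormed_orthonormal hy
  set a : ℕ → ℝ := fun k => (1 / 2) ^ k / ‖x k‖
  have hxk : ∀ k, 0 < ‖x k‖ := fun k => norm_pos_iff.2 (hx.ne_zero k)
  have ha : ∀ k, 0 < a k := fun k => div_pos (by positivity) (hxk k)
  have hsum : Summable fun k => tmulL X Y (a k • x k) (e k) := by
    refine Summable.of_norm_bounded summable_geometric_two fun k => ?_
    refine (norm_tmulL_apply_le _ _).trans_eq ?_
    rw [norm_smul, Real.norm_of_nonneg (ha k).le, he.1, mul_one]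
    exact div_mul_cancel₀ _ (hxk k).ne'
  refine ⟨∑' k, tmulL X Y (a k • x k) (e k), fun ⟨F, hF, hFw⟩ => ?_⟩
  refine LinearIndependent.not_finiteDimensional_of_mem hx (F := F) (fun k => ?_) hF
  have h := hFw (innerSL ℝ (e k))
  rw [ContinuousLinearMap.map_tsum _ hsum, tsum_eq_single k] at h
  · rw [slice_tmulL, innerSL_apply_apply, real_inner_self_eq_norm_sq, he.1, one_pow, one_smul] at h
    exact (F.smul_mem_iff (ha k).ne').1 h
  · intro j hj
    rw [slice_tmulL, innerSL_apply_apply, he.2 hj.symm, zero_smul]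

/-- Expanding each relevant `y n` in an orthonormal basis of `R` makes every slice a combination of
the slices along that basis. -/
theorem isFiniteRank_of_hasSum {z : ProjTensor X Y} {x : ℕ → X} {y : ℕ → Y}
    (hz : HasSum (fun n => tmulL X Y (x n) (y n)) z) {R : Submodule ℝ Y} [FiniteDimensional ℝ R]
    (hy : ∀ n, tmulL X Y (x n) (y n) ≠ 0 → y n ∈ R) : IsFiniteRank z := by
  let e := stdOrthonormalBasis ℝ R
  let v : Fin (Module.finrank ℝ R) → X := fun j => slice (innerSL ℝ (e j : Y)) z
  refine ⟨Submodule.span ℝ (Set.range v), FiniteDimensional.span_of_finite ℝ (Set.finite_range v),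
    fun c => ?_⟩
  have h : slice c z = ∑ j, c (e j) • v j := by
    refine ((slice c).hasSum hz).unique ?_
    convert hasSum_sum fun j (_ : j ∈ Finset.univ) =>
      (((slice (innerSL ℝ (e j : Y))).hasSum hz).const_smul (c (e j))) using 2 with n
    by_cases h0 : tmulL X Y (x n) (y n) = 0
    · simp [h0]
    · simp only [slice_tmulL, smul_smul, ← Finset.sum_smul, innerSL_apply_apply]
      congr 1
      have h1 := congrArg (fun r : R => c r) (e.sum_repr' ⟨y n, hy n h0⟩)
      simp only [← h1, AddSubmonoidClass.coe_finsetSum, Submodule.coe_smul, map_sum, map_smul,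
        Submodule.coe_inner, smul_eq_mul]
      exact Finset.sum_congr rfl fun j _ => mul_comm _ _
  rw [h]
  exact Submodule.sum_mem _ fun j _ => Submodule.smul_mem _ _ (Submodule.subset_span ⟨j, rfl⟩)

variable [CompleteSpace Y]

theorem isFiniteRank_of_mem_NApi (hX : NormLocallyDependsOnFinitelyManyCoordinates X)
    {z : ProjTensor X Y} (hz : z ∈ NApi X Y) : IsFiniteRank z := by
  obtain ⟨x, y, hcost, hsum⟩ := mem_NApi_iff.1 hz
  obtain ⟨g, hg, hgz⟩ := exists_dual_vector'' ℝ z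
  have hgle : ∀ a b, g (tmulL X Y a b) ≤ ‖a‖ * ‖b‖ := fun a b =>
    (le_abs_self _).trans ((g.le_of_opNorm_le hg _).trans
      (by rw [one_mul]; exact norm_tmulL_apply_le a b))
  have hgabs : ∀ a b, |g (tmulL X Y a b)| ≤ ‖a‖ * ‖b‖ := fun a b =>
    (g.le_of_opNorm_le hg _).trans (by rw [one_mul]; exact norm_tmulL_apply_le a b)
  -- The nonnegative gaps `‖x n‖ * ‖y n‖ - g (x n ⊗ y n)` sum to `‖z‖ - g z = 0`, so each vanishes.
  have hatt : ∀ n, g (tmulL X Y (x n) (y n)) = ‖x n‖ * ‖y n‖ := by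
    have h0 : HasSum (fun n => ‖x n‖ * ‖y n‖ - g (tmulL X Y (x n) (y n))) 0 := by
      have := hcost.sub (g.hasSum hsum)
      rwa [hgz, RCLike.ofReal_real_eq_id, id, sub_self] at this
    have h1 := (hasSum_zero_iff_of_nonneg fun n => sub_nonneg.2 (hgle (x n) (y n))).1 h0
    exact fun n => (sub_eq_zero.1 (congrFun h1 n)).symm
  let T : X →ₗ[ℝ] Y :=
    { toFun := fun a => (InnerProductSpace.toDual ℝ Y).symm (g ∘L tmulL X Y a)
      map_add' := fun a b => by simp
      map_smul' := fun r a => by simp }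
  have hTinner : ∀ a b, inner ℝ (T a) b = g (tmulL X Y a b) := fun a b =>
    InnerProductSpace.toDual_symm_apply
  have hT : ∀ a, ‖T a‖ ≤ ‖a‖ := fun a => by
    refine ((InnerProductSpace.toDual ℝ Y).symm.norm_map _).trans_le ?_
    exact ContinuousLinearMap.opNorm_le_bound _ (norm_nonneg a) fun b => hgabs a b
  have hTeq : ∀ n, y n ≠ 0 → ‖T (x n)‖ = ‖x n‖ := fun n hn => by
    refine le_antisymm (hT _) (le_of_mul_le_mul_right ?_ (norm_pos_iff.2 hn))
    rw [← hatt n, ← hTinner]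
    exact real_inner_le_norm _ _
  by_cases hne : ∃ n, tmulL X Y (x n) (y n) ≠ 0
  · obtain ⟨n, hn⟩ := hne
    have hxn : x n ≠ 0 := fun h => hn (by simp [h])
    have hyn : y n ≠ 0 := fun h => hn (by simp [h])
    have := hX.finiteDimensional_range hT hxn (hTeq n hyn)
    refine isFiniteRank_of_hasSum hsum (R := LinearMap.range T) fun m hm => ?_
    have hxm : x m ≠ 0 := fun h => hm (by simp [h])
    have hym : y m ≠ 0 := fun h => hm (by simp [h])
    -- Equality in Cauchy–Schwarz makes `y m` parallel to `T (x m)`, hence a member of the range.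
    have h1 : ‖y m‖ • T (x m) = ‖T (x m)‖ • y m := by
      rw [← inner_eq_norm_mul_iff_real, hTinner, hatt, hTeq m hym]
    rw [hTeq m hym] at h1
    refine ((LinearMap.range T).smul_mem_iff (norm_ne_zero_iff.2 hxm)).1 ?_
    rw [← h1]
    exact Submodule.smul_mem _ _ ⟨_, rfl⟩
  · push Not at hne
    exact isFiniteRank_of_hasSum hsum (R := ⊥) fun m hm => absurd (hne m) hm

theorem dense_compl_NApi (hX : NormLocallyDependsOnFinitelyManyCoordinates X)
    (hXinf : ¬ FiniteDimensional ℝ X) (hYinf : ¬ FiniteDimensional ℝ Y) :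
    Dense (NApi X Y)ᶜ := by
  obtain ⟨w, hw⟩ := exists_not_isFiniteRank hXinf hYinf
  intro z
  by_cases hz : z ∈ NApi X Y
  · rw [Metric.mem_closure_iff]
    intro ε hε
    have hδ : 0 < ε / (‖w‖ + 1) := by positivity
    refine ⟨z + (ε / (‖w‖ + 1)) • w, fun hmem => hw ?_, ?_⟩
    · exact (isFiniteRank_of_mem_NApi hX hz).of_add_smul hδ.ne' (isFiniteRank_of_mem_NApi hX hmem)
    · rw [dist_self_add_right, norm_smul, Real.norm_of_nonneg hδ.le, div_mul_eq_mul_div,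
        div_lt_iff₀ (by positivity)]
      nlinarith
  · exact subset_closure hz

end Hilbert

/-! ### The spaces `c₀(I)`. -/

section ZeroAtInfty

variable {I : Type*} [TopologicalSpace I]

theorem ZeroAtInfty.norm_le {f : C₀(I, ℝ)} {C : ℝ} (hC : 0 ≤ C) : ‖f‖ ≤ C ↔ ∀ i, |f i| ≤ C :=
  BoundedContinuousFunction.norm_le (f := f.toBCF) hC

theorem ZeroAtInfty.abs_apply_le_norm (f : C₀(I, ℝ)) (i : I) : |f i| ≤ ‖f‖ :=
  (ZeroAtInfty.norm_le (norm_nonneg f)).1 le_rfl i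

variable [DiscreteTopology I]

theorem ZeroAtInfty.finite_le_abs (f : C₀(I, ℝ)) {δ : ℝ} (hδ : 0 < δ) :
    {i | δ ≤ |f i|}.Finite := by
  have h := f.zero_at_infty'
  rw [cocompact_eq_cofinite] at h
  have h1 := (Metric.tendsto_nhds.1 h) δ hδ
  simpa [Filter.eventually_cofinite] using h1

/-- Restriction of a function to a finite set of coordinates. -/
def restrictTo (s : Finset I) : C₀(I, ℝ) →L[ℝ] C₀(I, ℝ) :=
  LinearMap.mkContinuous
    { toFun := fun f =>
        { toFun := Set.indicator (s : Set I) f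
          continuous_toFun := continuous_of_discreteTopology
          zero_at_infty' := by
            rw [cocompact_eq_cofinite]
            refine tendsto_const_nhds.congr' (EventuallyEq.symm ?_)
            filter_upwards [s.finite_toSet.compl_mem_cofinite] with i hi
            exact Set.indicator_of_notMem hi _ }
      map_add' := fun f g => by
        ext i
        exact congrFun (Set.indicator_add (s : Set I) f g) i
      map_smul' := fun c f => by
        ext i
        exact Set.indicator_const_smul_apply (s : Set I) c f i } 1 fun f => by
    rw [one_mul, ZeroAtInfty.norm_le (norm_nonneg f)]
    intro i
    by_cases hi : i ∈ (s : Set I)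
    · simpa [Set.indicator, Finset.mem_coe.1 hi] using ZeroAtInfty.abs_apply_le_norm f i
    · simp [Set.indicator, Finset.mem_coe.not.1 hi]

theorem restrictTo_apply_of_mem {s : Finset I} (f : C₀(I, ℝ)) {i : I} (hi : i ∈ s) :
    restrictTo s f i = f i :=
  Set.indicator_of_mem (Finset.mem_coe.2 hi) f

theorem restrictTo_apply_of_notMem {s : Finset I} (f : C₀(I, ℝ)) {i : I} (hi : i ∉ s) :
    restrictTo s f i = 0 :=
  Set.indicator_of_notMem (Finset.mem_coe.not.2 hi) f

theorem restrictTo_restrictTo (s : Finset I) (f : C₀(I, ℝ)) :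
    restrictTo s (restrictTo s f) = restrictTo s f := by
  ext i
  by_cases hi : i ∈ s
  · rw [restrictTo_apply_of_mem _ hi]
  · rw [restrictTo_apply_of_notMem _ hi, restrictTo_apply_of_notMem _ hi]

instance finiteDimensional_range_restrictTo (s : Finset I) :
    FiniteDimensional ℝ (LinearMap.range (restrictTo s).toLinearMap) := by
  let ρ : LinearMap.range (restrictTo s).toLinearMap →ₗ[ℝ] s → ℝ :=
    { toFun := fun f i => f.1 i
      map_add' := fun f g => rfl
      map_smul' := fun c f => rfl }
  refine FiniteDimensional.of_injective ρ ?_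
  rintro ⟨_, f, rfl⟩ ⟨_, g, rfl⟩ h
  refine Subtype.ext (ZeroAtInftyContinuousMap.ext fun i => ?_)
  by_cases hi : i ∈ s
  · exact congrFun h ⟨i, hi⟩
  · exact (restrictTo_apply_of_notMem f hi).trans (restrictTo_apply_of_notMem g hi).symm

variable (I)

theorem metricPiProperty_zeroAtInfty : MetricPiProperty C₀(I, ℝ) := by
  classical
  intro ε hε n x _
  let s : Finset I := Finset.univ.biUnion fun k =>
    (ZeroAtInfty.finite_le_abs (x k) (half_pos hε)).toFinset
  refine ⟨LinearMap.range (restrictTo s).toLinearMap, inferInstance, ⟨restrictTo s,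
    LinearMap.mkContinuous_norm_le _ zero_le_one _, fun a => ⟨a, rfl⟩, ?_⟩, fun k =>
    ⟨restrictTo s (x k), ⟨x k, rfl⟩, lt_of_le_of_lt ?_ (half_lt_self hε)⟩⟩
  · rintro _ ⟨a, rfl⟩
    exact restrictTo_restrictTo s a
  · rw [ZeroAtInfty.norm_le (half_pos hε).le]
    intro i
    rw [ZeroAtInftyContinuousMap.sub_apply]
    by_cases hi : i ∈ s
    · rw [restrictTo_apply_of_mem _ hi, sub_self, abs_zero]
      exact (half_pos hε).le
    · rw [restrictTo_apply_of_notMem _ hi, sub_zero]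
      by_contra! h
      exact hi (Finset.mem_biUnion.2 ⟨k, Finset.mem_univ k, by simpa using h.le⟩)

/-- Evaluation at a point, as a functional on `C₀(I, ℝ)`. -/
def evalL (i : I) : C₀(I, ℝ) →L[ℝ] ℝ :=
  LinearMap.mkContinuous
    { toFun := fun f => f i
      map_add' := fun _ _ => rfl
      map_smul' := fun _ _ => rfl } 1 fun f => by
    rw [one_mul]
    exact ZeroAtInfty.abs_apply_le_norm f i

theorem normLocallyDependsOnFinitelyManyCoordinates_zeroAtInfty :
    NormLocallyDependsOnFinitelyManyCoordinates C₀(I, ℝ) := by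
  intro x hx
  have hx0 : 0 < ‖x‖ := norm_pos_iff.2 hx
  set s : Finset I := (ZeroAtInfty.finite_le_abs x (half_pos hx0)).toFinset
  -- Within `‖x‖ / 4` of `x`, coordinates of `y` off `s` stay below `3‖x‖ / 4 < ‖y‖`, so the maximum
  -- over `s` alone gives the norm.
  refine ⟨‖x‖ / 4, by positivity, s.card, fun k => evalL I (s.equivFin.symm k), norm,
    continuous_norm, fun y hy => ?_⟩
  set v : Fin s.card → ℝ := fun k => evalL I (s.equivFin.symm k) y
  have hyx : ‖x‖ - ‖x‖ / 4 < ‖y‖ := by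
    have := norm_sub_norm_le x y
    rw [norm_sub_rev] at this
    linarith
  have hv : ∀ i ∈ s, |y i| ≤ ‖v‖ := fun i hi => by
    have := norm_le_pi_norm v (s.equivFin ⟨i, hi⟩)
    simp only [v, Equiv.symm_apply_apply] at this
    exact this
  refine le_antisymm ?_ ((pi_norm_le_iff_of_nonneg (norm_nonneg y)).2 fun k =>
    ZeroAtInfty.abs_apply_le_norm y _)
  by_contra! hlt
  have hmax : max ‖v‖ (‖x‖ - ‖x‖ / 4) < ‖y‖ := max_lt hlt hyx
  refine absurd hmax (not_lt.2 ((ZeroAtInfty.norm_le (by positivity)).2 fun i => ?_))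
  by_cases hi : i ∈ s
  · exact (hv i hi).trans (le_max_left _ _)
  · refine le_trans ?_ (le_max_right _ _)
    have h1 : |x i| < ‖x‖ / 2 := by
      by_contra! h
      exact hi (by simpa [s] using h)
    have h2 := ZeroAtInfty.abs_apply_le_norm (y - x) i
    rw [ZeroAtInftyContinuousMap.sub_apply] at h2
    have h3 := abs_sub_abs_le_abs_sub (y i) (x i)
    linarith

theorem not_finiteDimensional_zeroAtInfty [Infinite I] : ¬ FiniteDimensional ℝ C₀(I, ℝ) := by
  classical
  intro _
  let δ : I → C₀(I, ℝ) := fun i =>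
    { toFun := Pi.single i 1
      continuous_toFun := continuous_of_discreteTopology
      zero_at_infty' := by
        rw [cocompact_eq_cofinite]
        refine tendsto_const_nhds.congr' (EventuallyEq.symm ?_)
        filter_upwards [(Set.finite_singleton i).compl_mem_cofinite] with j hj
        exact Pi.single_eq_of_ne hj _ }
  let coeₗ : C₀(I, ℝ) →ₗ[ℝ] I → ℝ :=
    { toFun := fun f => f
      map_add' := fun _ _ => rfl
      map_smul' := fun _ _ => rfl }
  have h : LinearIndependent ℝ δ :=
    LinearIndependent.of_comp coeₗ (Pi.linearIndependent_single_one I ℝ)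
  exact not_finite_iff_infinite.2 ‹Infinite I› h.finite

end ZeroAtInfty

end NormAttainingTensors

end

theorem theorem3p3 {Y : Type*} [NormedAddCommGroup Y] [InnerProductSpace ℝ Y] [CompleteSpace Y] :
    (∀ (X : Type*) [NormedAddCommGroup X] [NormedSpace ℝ X] [CompleteSpace X],
      NormAttainingTensors.MetricPiProperty X →
      NormAttainingTensors.NormLocallyDependsOnFinitelyManyCoordinates X →
        Dense (NormAttainingTensors.NApi X Y) ∧
        (¬ FiniteDimensional ℝ X → ¬ FiniteDimensional ℝ Y →
          Dense (NormAttainingTensors.NApi X Y)ᶜ)) ∧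
    (∀ (I : Type*) [TopologicalSpace I] [DiscreteTopology I],
      NormAttainingTensors.MetricPiProperty C₀(I, ℝ) ∧
      NormAttainingTensors.NormLocallyDependsOnFinitelyManyCoordinates C₀(I, ℝ) ∧
      Dense (NormAttainingTensors.NApi C₀(I, ℝ) Y) ∧
      (Infinite I → ¬ FiniteDimensional ℝ Y →
        Dense (NormAttainingTensors.NApi C₀(I, ℝ) Y)ᶜ)) :=
  ⟨fun _ _ _ _ hπ hX => ⟨NormAttainingTensors.dense_NApi_of_metricPiProperty hπ,
      NormAttainingTensors.dense_compl_NApi hX⟩,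
    fun I _ _ => ⟨NormAttainingTensors.metricPiProperty_zeroAtInfty I,
      NormAttainingTensors.normLocallyDependsOnFinitelyManyCoordinates_zeroAtInfty I,
      NormAttainingTensors.dense_NApi_of_metricPiProperty
        (NormAttainingTensors.metricPiProperty_zeroAtInfty I),
      fun _ => NormAttainingTensors.dense_compl_NApi
        (NormAttainingTensors.normLocallyDependsOnFinitelyManyCoordinates_zeroAtInfty I)
        (NormAttainingTensors.not_finiteDimensional_zeroAtInfty I)⟩⟩
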